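/- Let $V=\{x_1,\dots,x_n\}$ ($n\ge 1$) be a set of data chunks, each consisting of $d\ge 1$ bits, let $G=(V,E)$ be an undirected simple graph, and let $1\le t\le n$. A file is a simple path $p$ in $G$ with $\ell(p)$ chunks (vertices), where $1\le \ell(p)\le t$; the set of all files is the file model $P(G,\le t)$. A linearly coded store of length $m$ is a sequence $s=(s_1,\dots,s_m)$ in which each entry is a bitwise XOR of data chunks, such that every chunk of every file can be recovered from the whole sequence. Here a chunk is recoverable from some entries of $s$ if it is a function of these entries, whatever the contents of the data chunks are. The stretch number $\mathrm{MinS}(s,p)$ of a file $p$ is the length of the shortest substring (block of consecutive entries) of $s$ from which all chunks of $p$ can be recovered, divided by $\ell(p)$. The stretch metric of $s$ is $\max_{p\in P(G,\le t)}\mathrm{MinS}(s,p)$, and a linearly coded store of length $m$ is optimal if it has the smallest stretch metric among all linearly coded stores of length $m$. **Theorem.** For any file model $P(G,\le t)$ there is an optimal linearly coded store $s=(s_1,\dots,s_{n+1})$ with one redundant chunk (that is, of length $m=n+1$), an integer $N$ with $1\le N\le n$, and a partition of $V$ into $\{x_{a_1},\dots,x_{a_{n-N}}\}$ and $\{x_{b_1},\dots,x_{b_N}\}$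 (with distinct chunks listed in each part), such that $s$ is obtained by interleaving the sequence of uncoded chunks $x_{a_1},\dots,x_{a_{n-N}}$ with the sequence $y_1,\dots,y_{N+1}$ given by $$y_i=\begin{cases}x_{b_1}, & i=1,\\ x_{b_{i-1}}\oplus x_{b_i}, & 1<i<N+1,\\ x_{b_N}, & i=N+1,\end{cases}$$ where $\oplus$ is the bitwise XOR and interleaving keeps the order of the entries within each of the two sequences. -/

import Mathlib

namespace Dedup

/-- The file model `P(G, ≤ t)`: all files, i.e. simple paths `(x_{i_1}, …, x_{i_ℓ})` in `G` with
`1 ≤ ℓ ≤ t` chunks. The length `ℓ(p)` of a file `p` is its number of chunks `p.length`. -/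
def fileModel {V : Type*} (G : SimpleGraph V) (t : ℕ) : Set (List V) :=
  {p | p ≠ [] ∧ p.IsChain G.Adj ∧ p.Nodup ∧ p.length ≤ t}

/-- Every single chunk is a file. -/
theorem singleton_mem_fileModel {V : Type*} (G : SimpleGraph V) {t : ℕ} (ht : 1 ≤ t) (v : V) :
    [v] ∈ fileModel G t :=
  ⟨by simp, by simp, by simp, by simpa using ht⟩

/-- A chunk of `d` bits. Addition is the bitwise XOR. -/
abbrev Chunk (d : ℕ) : Type := Fin d → ZMod 2

/-- A linearly coded sequence of `m` stored chunks. The entry at position `i` is the XOR of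
the data chunks `v` with `S i v = 1`. -/
abbrev LinStore (V : Type*) (m : ℕ) : Type _ := Fin m → V → ZMod 2

section Store

variable {V : Type*} [Fintype V] {m : ℕ}

/-- The `d`-bit content stored at position `i` when the data chunks have the contents `x`. -/
def content (d : ℕ) (S : LinStore V m) (x : V → Chunk d) (i : Fin m) : Chunk d :=
  ∑ v, S i v • x v

/-- The data chunk `v` can be recovered from the entries of the store at the positions in `I`:
some decoder outputs `v` from these entries, whatever the contents of the data chunks are. -/
def Recovers (d : ℕ) (S : LinStore V m) (I : Set (Fin m)) (v : V) : Prop :=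
  ∃ D : (I → Chunk d) → Chunk d, ∀ x : V → Chunk d, D (fun i => content d S x i) = x v

/-- The positions `s, s + 1, …, s + L - 1` (counted from `0`). -/
def window (m s L : ℕ) : Set (Fin m) :=
  {i | s ≤ (i : ℕ) ∧ (i : ℕ) < s + L}

/-- The length of the shortest substring of the store from which all chunks of the file `p` can
be recovered. -/
noncomputable def shortest (d : ℕ) (S : LinStore V m) (p : List V) : ℕ :=
  sInf {L | ∃ s, s + L ≤ m ∧ ∀ v ∈ p, Recovers d S (window m s L) v}

/-- The stretch number `MinS(S, p)`. -/
noncomputable def minS (d : ℕ) (S : LinStore V m) (p : List V) : ℝ :=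
  (shortest d S p : ℝ) / (p.length : ℝ)

/-- The stretch metric of a fixed store: the maximal stretch number over all files. -/
noncomputable def stretchMetric (d : ℕ) (G : SimpleGraph V) (t : ℕ) (S : LinStore V m) : ℝ :=
  sSup (minS d S '' fileModel G t)

/-- The linearly coded stores of length `m`: sequences of `m` linear combinations of the data
chunks that allow the recovery of every file. -/
def codedStores (d : ℕ) (G : SimpleGraph V) (t m : ℕ) : Set (LinStore V m) :=
  {S | ∀ p ∈ fileModel G t, ∀ v ∈ p, Recovers d S Set.univ v}

/-- An optimal linearly coded store of length `m`: it minimizes the stretch metric among all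
linearly coded stores of length `m`. -/
def IsOptimalStore (d : ℕ) (G : SimpleGraph V) (t : ℕ) (S : LinStore V m) : Prop :=
  S ∈ codedStores d G t m ∧ IsMinOn (stretchMetric d G t) (codedStores d G t m) S

/-- The set of files is finite, so that the supremum in `stretchMetric` is a maximum. -/
theorem fileModel_finite (G : SimpleGraph V) (t : ℕ) : (fileModel G t).Finite :=
  (List.finite_length_le V t).subset fun _ hp => hp.2.2.2

/-- In a coded store the whole store recovers every file, so that the infimum in `shortest` is a
minimum. -/
theorem shortest_spec {d : ℕ} {G : SimpleGraph V} {t : ℕ} {S : LinStore V m}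
    (hS : S ∈ codedStores d G t m) {p : List V} (hp : p ∈ fileModel G t) :
    ∃ s, s + shortest d S p ≤ m ∧ ∀ v ∈ p, Recovers d S (window m s (shortest d S p)) v := by
  have hne : {L | ∃ s, s + L ≤ m ∧ ∀ v ∈ p, Recovers d S (window m s L) v}.Nonempty := by
    refine ⟨m, 0, by simp, fun v hv => ?_⟩
    have hw : window m 0 m = Set.univ := by
      ext i
      simp [window]
    rw [hw]
    exact hS p hp v hv
  exact Nat.sInf_mem hne

end Store

section Chain

variable {V : Type*} [DecidableEq V]

/-- The uncoded chunk `x_v`, as a linear combination of the data chunks. -/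
def uncoded (v : V) : V → ZMod 2 := Pi.single v 1

/-- The chain `y_1, …, y_{N+1}` on the chunks `b_1, …, b_N` (`N ≥ 1`): `y_1 = x_{b_1}`,
`y_{N+1} = x_{b_N}` and `y_i = x_{b_{i-1}} ⊕ x_{b_i}` otherwise. All indices are shifted by one,
as positions in `Fin` are counted from `0`. -/
def chain {N : ℕ} (hN : 1 ≤ N) (b : Fin N → V) (i : Fin (N + 1)) : V → ZMod 2 :=
  if h0 : (i : ℕ) = 0 then uncoded (b ⟨0, by omega⟩)
  else if h1 : (i : ℕ) = N then uncoded (b ⟨N - 1, by omega⟩)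
  else uncoded (b ⟨i - 1, by omega⟩) + uncoded (b ⟨i, by omega⟩)

end Chain

/-- The sequence `z` is an interleaving of the sequences `u` and `w`: its positions split into two
disjoint subsequences, along which one reads `u` and `w`, each in its order. -/
def IsInterleaving {α : Type*} {k l m : ℕ} (u : Fin k → α) (w : Fin l → α) (z : Fin m → α) :
    Prop :=
  ∃ (f : Fin k → Fin m) (g : Fin l → Fin m), StrictMono f ∧ StrictMono g ∧
    Function.Bijective (Sum.elim f g) ∧ (∀ i, z (f i) = u i) ∧ ∀ j, z (g j) = w j

end Dedup

namespace Dedup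

/-! Every coded store is dominated, window by window, by a store of the required form; dominating a
minimizer of the stretch metric then suffices. The `n + 1` entries span a space of dimension `n`
over `ZMod 2`, so they satisfy exactly one nonzero relation `δ`. A relation on a single position is
a zero entry, which `exists_relation` overwrites. Each chunk `v` then has exactly two
representations, `α v` and `α v + δ`, and a window recovers `v` iff it contains one of their
supports. Let `p 0 < … < p (K + 1)` support `δ`. The coordinates of `α v` off this support and the
sums of its coordinates at consecutive `p c` form a nonsingular `n × n` matrix. A transversal of it
(`exists_transversal`) places the chunks: each goes uncoded to a position that every recovering
window contains, or cuts the support in two so that every recovering window contains one whole side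
(`exists_placement`). The support positions not taken by uncoded chunks carry the chain, where
either side of a cut sums to the chunk at the cut (`sum_prefix_chain`). -/

theorem add_self_eq_zero_zmod_two {V : Type*} (f : V → ZMod 2) : f + f = 0 :=
  funext fun _ => CharTwo.add_self_eq_zero _

/-! ### Recovery as membership in a linear span -/

section Recovery

variable {V : Type*} [Fintype V] [DecidableEq V] {m d : ℕ} {S : LinStore V m}

theorem recovers_of_sum_eq {I : Set (Fin m)} {v : V} (α : Fin m → ZMod 2)
    (hI : ∀ i, α i ≠ 0 → i ∈ I) (hα : ∑ i, α i • S i = uncoded v) : Recovers d S I v := by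
  classical
  refine ⟨fun y => ∑ i, if h : i ∈ I then α i • y ⟨i, h⟩ else 0, fun x => ?_⟩
  have h1 : ∀ i, (if h : i ∈ I then α i • content d S x i else 0) = α i • content d S x i := by
    intro i
    split_ifs with h
    · rfl
    · rw [not_imp_comm.1 (hI i) h, zero_smul]
  change ∑ i, (if h : i ∈ I then α i • content d S x i else 0) = x v
  rw [Finset.sum_congr rfl fun i _ => h1 i]
  simp only [content, Finset.smul_sum, smul_smul]
  rw [Finset.sum_comm]
  simp only [← Finset.sum_smul]
  have h2 : ∀ w, ∑ i, α i * S i w = uncoded v w := fun w => by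
    rw [← hα]; simp
  simp only [h2, uncoded]
  simp [Pi.single_apply]

theorem recovers_of_sum_finset {I : Set (Fin m)} {v : V} (A : Finset (Fin m))
    (hI : ∀ i ∈ A, i ∈ I) (hA : ∑ i ∈ A, S i = uncoded v) : Recovers d S I v := by
  refine recovers_of_sum_eq (fun i => if i ∈ A then 1 else 0) (fun i hi => hI i ?_) ?_
  · by_contra h
    simp [h] at hi
  · simpa [ite_smul] using hA

theorem Recovers.exists_sum_eq (hd : 1 ≤ d) {I : Set (Fin m)} {v : V} (h : Recovers d S I v) :
    ∃ α : Fin m → ZMod 2, (∀ i, α i ≠ 0 → i ∈ I) ∧ ∑ i, α i • S i = uncoded v := by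
  classical
  have hmem : uncoded v ∈ Submodule.span (ZMod 2) (S '' I) := by
    -- A functional `φ` that kills the entries in `I` but not `uncoded v` gives contents, `φ
    -- (uncoded w)` in every bit of `w`, that the decoder cannot tell from zero. Since `1 ≤ d`,
    -- there is a bit where `v` differs.
    by_contra hv
    obtain ⟨φ, hφv, hφ⟩ := Submodule.exists_le_ker_of_notMem hv
    obtain ⟨D, hD⟩ := h
    have hφS : ∀ i ∈ I, φ (S i) = 0 := fun i hi =>
      hφ (Submodule.subset_span (Set.mem_image_of_mem S hi))
    have hexp : ∀ f : V → ZMod 2, φ f = ∑ w, f w * φ (uncoded w) := fun f => by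
      conv_lhs => rw [pi_eq_sum_univ' f]
      simp only [map_sum, map_smul, smul_eq_mul]
      rfl
    have h1 := hD (fun w _ => φ (uncoded w))
    have h0 := hD 0
    have hc : (fun i : I => content d S (fun w _ => φ (uncoded w)) i) =
        fun i : I => content d S 0 i := by
      funext i k
      simp only [content, Finset.sum_apply, Pi.smul_apply, smul_eq_mul, Pi.zero_apply, mul_zero,
        Finset.sum_const_zero]
      rw [← hexp]
      exact hφS i i.2
    rw [hc, h0] at h1
    exact hφv (congrFun h1 ⟨0, hd⟩).symm
  obtain ⟨α, hα, hsum⟩ := (Finsupp.mem_span_image_iff_linearCombination _).1 hmem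
  refine ⟨α, fun i hi => hα (by simpa using hi), ?_⟩
  rw [← hsum, Finsupp.linearCombination_apply, Finsupp.sum_fintype _ _ (by simp)]

end Recovery

/-! ### Chains and interleavings -/

section Chain

variable {V : Type*} [DecidableEq V] {N : ℕ}

/-- Padding the chunks with zero at both ends removes the case distinction, so that sums along the
chain telescope. -/
theorem chain_eq_add (hN : 1 ≤ N) (b : Fin N → V) (B : ℕ → V → ZMod 2) (h0 : B 0 = 0)
    (hB : ∀ i : Fin N, B (i + 1) = uncoded (b i)) (hl : B (N + 1) = 0) (i : Fin (N + 1)) :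
    chain hN b i = B i + B (i + 1) := by
  unfold chain
  split_ifs with h h'
  · rw [h, h0, ← hB]; simp
  · rw [h', hl, ← hB, add_zero]
    congr 1
    simp only
    omega
  · rw [← hB, ← hB]
    congr 2
    simp only
    omega

theorem sum_prefix_chain (hN : 1 ≤ N) (b : Fin N → V) (j : Fin N) :
    ∑ i ∈ Finset.univ.filter (· ≤ j.castSucc), chain hN b i = uncoded (b j) ∧
    ∑ i ∈ Finset.univ.filter (fun i => ¬ i ≤ j.castSucc), chain hN b i = uncoded (b j) := by
  obtain ⟨B, h0, hB, hl⟩ : ∃ B : ℕ → V → ZMod 2, B 0 = 0 ∧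
      (∀ i : Fin N, B (i + 1) = uncoded (b i)) ∧ B (N + 1) = 0 :=
    ⟨fun k => if h : 1 ≤ k ∧ k ≤ N then uncoded (b ⟨k - 1, by omega⟩) else 0, by simp,
      fun i => by simp, by simp⟩
  have htel : ∀ r M : ℕ, ∑ k ∈ Finset.range M, (if k ≤ r then B k + B (k + 1) else 0) =
      B (min M (r + 1)) := by
    intro r M
    induction M with
    | zero => simp [h0]
    | succ M ih =>
      rw [Finset.sum_range_succ, ih]
      split_ifs with h
      · rw [min_eq_left (by omega), min_eq_left (by omega), ← add_assoc, add_self_eq_zero_zmod_two,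
          zero_add]
      · rw [min_eq_right (by omega), min_eq_right (by omega), add_zero]
  have hpre : ∀ r : ℕ, ∑ i : Fin (N + 1), (if (i : ℕ) ≤ r then chain hN b i else 0) =
      B (min (N + 1) (r + 1)) := fun r => by
    rw [← htel r, Finset.sum_range]
    exact Finset.sum_congr rfl fun i _ => by rw [chain_eq_add hN b B h0 hB hl]
  have h1 : ∑ i ∈ Finset.univ.filter (· ≤ j.castSucc), chain hN b i = uncoded (b j) := by
    rw [Finset.sum_filter, ← hB, ← min_eq_right (show (j : ℕ) + 1 ≤ N + 1 by omega), ← hpre]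
    rfl
  refine ⟨h1, ?_⟩
  -- The whole chain sums to zero, so in characteristic 2 each suffix sum equals the complementary
  -- prefix sum.
  have hall : ∑ i, chain hN b i = 0 := by
    have := hpre N
    rw [min_self, hl] at this
    rw [← this]
    exact Finset.sum_congr rfl fun i _ => by rw [if_pos (by omega)]
  rw [← Finset.sum_filter_add_sum_filter_not Finset.univ (· ≤ j.castSucc), h1] at hall
  rw [← zero_add (∑ i ∈ _, _), ← add_self_eq_zero_zmod_two (uncoded (b j)), add_assoc, hall,
    add_zero]

end Chain

/-- A choice of positions `D` for a chain and a placement `θ` of the data chunks, in which each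
chunk is put uncoded at a position outside `D` or becomes a member of the chain, determines a store
that interleaves uncoded chunks with a chain. -/
theorem exists_interleaving_store {V : Type*} [Fintype V] [DecidableEq V] {n N : ℕ} (hN : 1 ≤ N)
    (hNn : N ≤ n) (D : Finset (Fin (n + 1))) (hD : D.card = N + 1)
    (θ : V ≃ {i // i ∉ D} ⊕ Fin N) :
    ∃ (S : LinStore V (n + 1)) (a : Fin (n - N) → V) (b : Fin N → V),
      Function.Bijective (Sum.elim a b) ∧
      IsInterleaving (fun i => uncoded (a i)) (chain hN b) S ∧
      (∀ p : {i // i ∉ D}, S p = uncoded (θ.symm (Sum.inl p))) ∧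
      ∀ j : Fin N,
        ∑ i ∈ Finset.univ.filter (· ≤ j.castSucc), S (D.orderEmbOfFin hD i) =
          uncoded (θ.symm (Sum.inr j)) ∧
        ∑ i ∈ Finset.univ.filter (fun i => ¬ i ≤ j.castSucc), S (D.orderEmbOfFin hD i) =
          uncoded (θ.symm (Sum.inr j)) := by
  classical
  have hDc : Dᶜ.card = n - N := by
    rw [Finset.card_compl, hD, Fintype.card_fin]; omega
  let b : Fin N → V := fun j => θ.symm (Sum.inr j)
  let e : Fin (n - N) ≃ {i // i ∉ D} :=
    (Dᶜ.orderIsoOfFin hDc).toEquiv.trans (Equiv.subtypeEquivRight fun i => by simp)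
  let a : Fin (n - N) → V := fun i => θ.symm (Sum.inl (e i))
  let S : LinStore V (n + 1) := fun p =>
    if h : p ∈ D then chain hN b ((D.orderIsoOfFin hD).symm ⟨p, h⟩)
    else uncoded (θ.symm (Sum.inl ⟨p, h⟩))
  have hSg : ∀ i, S (D.orderEmbOfFin hD i) = chain hN b i := fun i => by
    have h := D.orderEmbOfFin_mem hD i
    simp only [S, dif_pos h]
    congr 1
    rw [OrderIso.symm_apply_eq]
    rfl
  have hSf : ∀ p : {i // i ∉ D}, S p = uncoded (θ.symm (Sum.inl p)) := fun p => by
    simp only [S, dif_neg p.2]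
  refine ⟨S, a, b, ?_, ⟨Dᶜ.orderEmbOfFin hDc, D.orderEmbOfFin hD, OrderEmbedding.strictMono _,
    OrderEmbedding.strictMono _, ⟨?_, ?_⟩, fun i => hSf (e i), hSg⟩, hSf, fun j => ?_⟩
  · have : Sum.elim a b = (Equiv.sumCongr e (Equiv.refl _)).trans θ.symm := by
      ext x
      cases x <;> rfl
    rw [this]
    exact Equiv.bijective _
  · refine Function.Injective.sumElim (RelEmbedding.injective _) (RelEmbedding.injective _)
      fun i j hij => ?_
    have h1 := Dᶜ.orderEmbOfFin_mem hDc i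
    rw [hij] at h1
    exact Finset.mem_compl.1 h1 (D.orderEmbOfFin_mem hD j)
  · intro p
    by_cases hp : p ∈ D
    · obtain ⟨i, hi⟩ := (D.range_orderEmbOfFin hD).symm ▸ (Finset.mem_coe.2 hp)
      exact ⟨Sum.inr i, hi⟩
    · obtain ⟨i, hi⟩ := (Dᶜ.range_orderEmbOfFin hDc).symm ▸
        (Finset.mem_coe.2 (Finset.mem_compl.2 hp))
      exact ⟨Sum.inl i, hi⟩
  · simp only [hSg]
    exact sum_prefix_chain hN b j

/-! ### Transversals from determinants -/

/-- If every column of a nonsingular matrix is a sum, some choice of summands, one for each column,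
is nonsingular. -/
theorem exists_det_ne_zero_of_column_sum {C T F : Type*} [Fintype C] [DecidableEq C] [Fintype T]
    [Field F] (M : Matrix C C F) (hM : M.det ≠ 0) (f : C → T → C → F)
    (hf : ∀ w c, M w c = ∑ t, f c t w) :
    ∃ τ : C → T, (Matrix.of fun w c => f c (τ c) w).det ≠ 0 := by
  by_contra! h
  apply hM
  have hMT : M.transpose = fun c => ∑ t, f c t := by
    funext c w
    simp [hf, Finset.sum_apply]
  have key := (Matrix.detRowAlternating (n := C) (R := F)).toMultilinearMap.map_sum f
  rw [← Matrix.det_transpose, hMT]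
  refine key.trans (Finset.sum_eq_zero fun τ _ => ?_)
  have := h τ
  rw [← Matrix.det_transpose] at this
  exact this

/-- A transversal of a nonsingular matrix in which the columns indexed by `κ` are sums of two
coordinates. Rows that vanish at `o` use one of the two coordinates, and no coordinate is used
twice; the other rows use the sum. -/
theorem exists_transversal {V A κ ι F : Type*} [Fintype V] [Fintype A] [Fintype κ]
    [Field F] (hcard : Fintype.card A + Fintype.card κ = Fintype.card V) (α : V → ι → F)
    (x : A → ι) (l r : κ → ι) (o : ι)
    (hind : ∀ u : V → F, (∀ a, ∑ v, u v * α v (x a) = 0) →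
      (∀ c, ∑ v, u v * (α v (l c) + α v (r c)) = 0) → u = 0) :
    ∃ (σ : A ⊕ κ ≃ V) (τ : κ → Option Bool),
      (∀ a, α (σ (Sum.inl a)) (x a) ≠ 0) ∧
      (∀ c, τ c = none → α (σ (Sum.inr c)) o ≠ 0 ∧
        α (σ (Sum.inr c)) (l c) + α (σ (Sum.inr c)) (r c) ≠ 0) ∧
      (∀ c t, τ c = some t → α (σ (Sum.inr c)) o = 0 ∧
        α (σ (Sum.inr c)) (if t then r c else l c) ≠ 0) ∧
      ∀ c t c' t', τ c = some t → τ c' = some t' →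
        (if t then r c else l c) = (if t' then r c' else l c') → c = c' := by
  classical
  obtain ⟨e⟩ : Nonempty (A ⊕ κ ≃ V) := Fintype.card_eq.1 (by simpa using hcard)
  -- `none` keeps the whole sum on the rows nonzero at `o`; `some false` and `some true` are its two
  -- summands on the rows that vanish at `o`.
  let f : A ⊕ κ → Option Bool → A ⊕ κ → F := fun c t w =>
    match c, t with
    | Sum.inl a, none => α (e w) (x a)
    | Sum.inl _, some _ => 0
    | Sum.inr c, none => if α (e w) o = 0 then 0 else α (e w) (l c) + α (e w) (r c)
    | Sum.inr c, some t => if α (e w) o = 0 then α (e w) (if t then r c else l c) else 0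
  let M : Matrix (A ⊕ κ) (A ⊕ κ) F := Matrix.of fun w c =>
    Sum.elim (fun a => α (e w) (x a)) (fun c => α (e w) (l c) + α (e w) (r c)) c
  have hM : M.det ≠ 0 := by
    intro h0
    obtain ⟨u, hu, hu0⟩ := Matrix.exists_vecMul_eq_zero_iff.2 h0
    have hsum : ∀ c, ∑ v, u (e.symm v) * M (e.symm v) c = 0 := fun c => by
      rw [Equiv.sum_comp e.symm (fun w => u w * M w c)]
      exact congrFun hu0 c
    have := hind (fun v => u (e.symm v)) (fun a => by simpa [M] using hsum (Sum.inl a))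
      (fun c => by simpa [M] using hsum (Sum.inr c))
    exact hu (funext fun w => by simpa using congrFun this (e w))
  obtain ⟨τ, hτ⟩ := exists_det_ne_zero_of_column_sum M hM f (by
    rintro w (a | c)
    · simp [M, f, Fintype.sum_option]
    · by_cases h : α (e w) o = 0
      · simp [M, f, Fintype.sum_option, h, add_comm]
      · simp [M, f, Fintype.sum_option, h])
  have hτ' := hτ
  rw [Matrix.det_apply] at hτ'
  -- A nonzero term of the Leibniz expansion is the transversal.
  obtain ⟨σ, -, hσ⟩ := Finset.exists_ne_zero_of_sum_ne_zero hτ'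
  have hne : ∀ c, f c (τ c) (σ c) ≠ 0 := fun c hc => hσ (by
    rw [Finset.prod_eq_zero (Finset.mem_univ c) (by simpa using hc), smul_zero])
  refine ⟨σ.trans e, fun c => τ (Sum.inr c), fun a => ?_, fun c hc => ?_, fun c t hc => ?_,
    fun c t c' t' hc hc' h => ?_⟩
  · have := hne (Sum.inl a)
    rcases h : τ (Sum.inl a) with _ | t
    · simpa [f, h] using this
    · simp [f, h] at this
  · have := hne (Sum.inr c)
    simpa [f, hc] using this
  · have := hne (Sum.inr c)
    simpa [f, hc] using this
  -- A coordinate used twice would give two equal columns; this needs the determinant, not just its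
  -- nonzero term.
  · by_contra hcc
    refine hτ (Matrix.det_zero_of_column_eq (i := Sum.inr c) (j := Sum.inr c') (by simpa using hcc)
      fun w => ?_)
    simp only [Matrix.of_apply, f, hc, hc', h]

/-! ### Placing the chunks along the relation -/

/-- The only nontrivial relation between `n + 1` vectors that span a space of dimension `n`. -/
theorem eq_zero_or_eq_of_sum_eq_zero {V : Type*} [Fintype V] [DecidableEq V] {n : ℕ}
    (hV : Fintype.card V = n) (S : LinStore V (n + 1))
    (hS : ∀ v, ∃ α : Fin (n + 1) → ZMod 2, ∑ i, α i • S i = uncoded v)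
    {δ : Fin (n + 1) → ZMod 2} (hδ0 : δ ≠ 0) (hδ : ∑ i, δ i • S i = 0)
    {β : Fin (n + 1) → ZMod 2} (hβ : ∑ i, β i • S i = 0) : β = 0 ∨ β = δ := by
  let L := Fintype.linearCombination (ZMod 2) S
  have hL : ∀ γ, L γ = ∑ i, γ i • S i := fun γ => Fintype.linearCombination_apply _ _ _
  have hrange : L.range = ⊤ := by
    rw [eq_top_iff, ← (Pi.basisFun (ZMod 2) V).span_eq, Submodule.span_le]
    rintro _ ⟨v, rfl⟩
    obtain ⟨α, hα⟩ := hS v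
    exact ⟨α, by rw [hL, hα, Pi.basisFun_apply]; rfl⟩
  have hfin := LinearMap.finrank_range_add_finrank_ker L
  rw [hrange, finrank_top, Module.finrank_fintype_fun_eq_card, Module.finrank_fintype_fun_eq_card,
    hV, Fintype.card_fin] at hfin
  -- Rank-nullity leaves a line, which over `ZMod 2` has one nonzero vector.
  have hker : Module.finrank (ZMod 2) L.ker = 1 := by omega
  have hδker : δ ∈ L.ker := by rw [LinearMap.mem_ker, hL, hδ]
  have hβker : β ∈ L.ker := by rw [LinearMap.mem_ker, hL, hβ]
  obtain ⟨c, hc⟩ := (finrank_eq_one_iff_of_nonzero' (⟨δ, hδker⟩ : L.ker)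
    (fun h => hδ0 (congrArg Subtype.val h))).1 hker ⟨β, hβker⟩
  have hc' : c • δ = β := congrArg Subtype.val hc
  have h01 : ∀ c : ZMod 2, c = 0 ∨ c = 1 := by decide
  rcases h01 c with rfl | rfl
  · left; rw [← hc', zero_smul]
  · right; rw [← hc', one_smul]

theorem exists_orderEmbOfFin_eq {ι : Type*} [LinearOrder ι] {k : ℕ} (D : Finset ι)
    (hD : D.card = k) {y : ι} (hy : y ∈ D) : ∃ i, D.orderEmbOfFin hD i = y := by
  rwa [← Finset.mem_coe, ← D.range_orderEmbOfFin hD] at hy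

/-- A threshold between the least and the greatest element of a finite set cuts it in two. -/
theorem exists_orderEmbOfFin_le_iff {ι : Type*} [LinearOrder ι] {N : ℕ} (D : Finset ι)
    (hD : D.card = N + 1) (x : ι) (hlo : ∃ y ∈ D, y ≤ x) (hhi : ∃ y ∈ D, x < y) :
    ∃ j : Fin N, ∀ i, D.orderEmbOfFin hD i ≤ x ↔ i ≤ j.castSucc := by
  classical
  obtain ⟨y, hy, hyx⟩ := hlo
  obtain ⟨z, hz, hxz⟩ := hhi
  obtain ⟨iy, rfl⟩ := exists_orderEmbOfFin_eq D hD hy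
  obtain ⟨iz, rfl⟩ := exists_orderEmbOfFin_eq D hD hz
  have hne : (Finset.univ.filter fun i => D.orderEmbOfFin hD i ≤ x).Nonempty := ⟨iy, by simpa⟩
  let k := Finset.max' _ hne
  have hk : D.orderEmbOfFin hD k ≤ x := by simpa using Finset.max'_mem _ hne
  have hkz : k < iz := (D.orderEmbOfFin hD).lt_iff_lt.1 (hk.trans_lt hxz)
  refine ⟨⟨k, by omega⟩, fun i => ⟨fun hi => Finset.le_max' _ _ (by simpa using hi), fun hi => ?_⟩⟩
  exact ((D.orderEmbOfFin hD).monotone hi).trans hk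

/-- If some edges of a path each delete one of their ends, then between two of the other edges a
vertex remains. -/
theorem exists_not_deleted_between {K : ℕ} (τ : Fin (K + 1) → Option Bool) {c c' : Fin (K + 1)}
    (hcc : c < c') (hc : τ c = none) (hc' : τ c' = none) :
    ∃ j : Fin (K + 2), c.castSucc < j ∧ j ≤ c'.castSucc ∧
      ∀ e t, τ e = some t → (if t then e.succ else e.castSucc) ≠ j := by
  by_contra! h
  -- The premise sits inside the existential, so `choose` gives a total function, with default `0`
  -- off the interval.
  have h' : ∀ j : ℕ, ∃ e : ℕ, j ∈ Finset.Ioc (c : ℕ) c' → e ∈ Finset.Ioo (c : ℕ) c' ∧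
      ∃ (he : e < K + 1) (t : Bool), τ ⟨e, he⟩ = some t ∧ j = if t then e + 1 else e := by
    intro j
    by_cases hj : j ∈ Finset.Ioc (c : ℕ) c'
    · rw [Finset.mem_Ioc] at hj
      obtain ⟨e, t, he, hej⟩ := h ⟨j, by omega⟩ (Fin.lt_def.2 hj.1) (Fin.le_def.2 hj.2)
      have hec : (e : ℕ) ≠ c := fun h => by
        rw [Fin.ext h, hc] at he; cases he
      have hec' : (e : ℕ) ≠ c' := fun h => by
        rw [Fin.ext h, hc'] at he; cases he
      have hej' : j = if t then (e : ℕ) + 1 else e := by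
        rw [Fin.ext_iff] at hej
        cases t <;> simpa using hej.symm
      refine ⟨e, fun _ => ⟨?_, e.2, t, he, hej'⟩⟩
      rw [Finset.mem_Ioo]
      cases t <;> simp at hej' <;> omega
    · exact ⟨0, fun h => absurd h hj⟩
  choose e he using h'
  -- There are `c' - c` vertices but only `c' - c - 1` edges strictly between, and an edge deletes
  -- just one end.
  obtain ⟨x, hx, y, hy, hxy, hexy⟩ := Finset.exists_ne_map_eq_of_card_lt_of_maps_to
    (s := Finset.Ioc (c : ℕ) c') (t := Finset.Ioo (c : ℕ) c')
    (by simp only [Nat.card_Ioc, Nat.card_Ioo]; rw [Fin.lt_def] at hcc; omega)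
    (f := e) (fun j hj => (he j hj).1)
  obtain ⟨-, h1, t, ht, hxt⟩ := he x hx
  obtain ⟨-, h2, t', ht', hyt⟩ := he y hy
  apply hxy
  rw [hxt, hyt]
  have : some t = some t' := by
    rw [← ht, ← ht']
    simp only [hexy]
  rw [Option.some.inj this, hexy]

/-- A store whose only relation is supported on at least two positions admits a placement of the
data chunks that respects recovery from every substring. -/
theorem exists_placement {V : Type*} [Fintype V] [DecidableEq V] {n : ℕ}
    (hV : Fintype.card V = n) (S : LinStore V (n + 1))
    (hS : ∀ v, ∃ α : Fin (n + 1) → ZMod 2, ∑ i, α i • S i = uncoded v)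
    {K : ℕ} (p : Fin (K + 2) ↪o Fin (n + 1)) (hp : ∑ j, S (p j) = 0) :
    ∃ (N : ℕ) (_ : 1 ≤ N) (_ : N ≤ n) (D : Finset (Fin (n + 1))) (hD : D.card = N + 1)
      (θ : V ≃ {i // i ∉ D} ⊕ Fin N),
      ∀ (v : V) (W : Set (Fin (n + 1))), W.OrdConnected →
        (∃ β : Fin (n + 1) → ZMod 2, (∀ i, β i ≠ 0 → i ∈ W) ∧ ∑ i, β i • S i = uncoded v) →
        (∀ i, θ v = Sum.inl i → (i : Fin (n + 1)) ∈ W) ∧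
        ∀ j, θ v = Sum.inr j → (∀ i ≤ j.castSucc, D.orderEmbOfFin hD i ∈ W) ∨
          ∀ i, ¬ i ≤ j.castSucc → D.orderEmbOfFin hD i ∈ W := by
  classical
  have h01 : ∀ c : ZMod 2, c = 0 ∨ c = 1 := by decide
  -- the relation
  let δ : Fin (n + 1) → ZMod 2 := fun i => if i ∈ Set.range p then 1 else 0
  have hδp : ∀ j, δ (p j) = 1 := fun j => if_pos ⟨j, rfl⟩
  have hδn : ∀ i, i ∉ Set.range p → δ i = 0 := fun i hi => if_neg hi
  have hδS : ∑ i, δ i • S i = 0 := by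
    rw [← hp]
    refine (Fintype.sum_of_injective p p.injective (fun j => S (p j)) _ (fun i hi => ?_)
      fun j => ?_).symm
    · rw [hδn i hi, zero_smul]
    · rw [hδp, one_smul]
  have hδ0 : δ ≠ 0 := fun h => by
    have := hδp 0
    rw [h] at this
    exact zero_ne_one this
  -- representations of the chunks, normalized at the last position of the relation
  have hex : ∀ v, ∃ α : Fin (n + 1) → ZMod 2, ∑ i, α i • S i = uncoded v ∧
      α (p (Fin.last _)) = 0 := by
    intro v
    obtain ⟨α, hα⟩ := hS v
    rcases h01 (α (p (Fin.last _))) with h | h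
    · exact ⟨α, hα, h⟩
    · refine ⟨α + δ, ?_, ?_⟩
      · simp only [Pi.add_apply, add_smul, Finset.sum_add_distrib, hα, hδS, add_zero]
      · rw [Pi.add_apply, h, hδp]; rfl
  choose α hα hαl using hex
  have hrep : ∀ v (β : Fin (n + 1) → ZMod 2), ∑ i, β i • S i = uncoded v →
      β = α v ∨ β = α v + δ := by
    intro v β hβ
    have := eq_zero_or_eq_of_sum_eq_zero hV S hS hδ0 hδS (β := β - α v) (by
      simp only [Pi.sub_apply, sub_smul, Finset.sum_sub_distrib, hα, hβ, sub_self])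
    rcases this with h | h
    · exact Or.inl (sub_eq_zero.1 h)
    · exact Or.inr (by rw [← h]; abel)
  have hcompl : Fintype.card {i // i ∉ Set.range p} + Fintype.card (Fin (K + 1)) =
      Fintype.card V := by
    have h1 := Fintype.card_subtype_compl (fun i => i ∈ Set.range p)
    have h2 : Fintype.card {i // i ∈ Set.range p} = K + 2 := by
      rw [← Fintype.card_congr (Equiv.ofInjective p p.injective), Fintype.card_fin]
    have h3 : K + 2 ≤ n + 1 := by simpa using Fintype.card_le_of_embedding p.toEmbedding
    rw [h1, h2, hV, Fintype.card_fin, Fintype.card_fin]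
    omega
  obtain ⟨σ, τ, hA, hout, hin, hinj⟩ := exists_transversal (F := ZMod 2) hcompl α
    (fun a => (a : Fin (n + 1))) (fun c => p c.castSucc) (fun c => p c.succ) (p 0) (by
      intro u hu1 hu2
      -- `β` vanishes off the relation and is constant on it, so it is a multiple of `δ`. Hence the
      -- combination of entries it defines is zero, but it also equals `u`.
      let β : Fin (n + 1) → ZMod 2 := fun i => ∑ v, u v * α v i
      have hβp : ∀ j, β (p j) = β (p 0) := by
        intro j
        induction j using Fin.induction with
        | zero => rfl
        | succ c ih =>
          rw [← ih]
          have := hu2 c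
          simp only [mul_add, Finset.sum_add_distrib] at this
          exact (CharTwo.add_eq_zero.1 this).symm
      have hβ : β = β (p 0) • δ := by
        funext i
        by_cases hi : i ∈ Set.range p
        · obtain ⟨j, rfl⟩ := hi
          rw [Pi.smul_apply, hδp, hβp, smul_eq_mul, mul_one]
        · rw [Pi.smul_apply, hδn i hi, smul_zero]
          exact hu1 ⟨i, hi⟩
      have h0 : ∑ i, β i • S i = 0 := by
        rw [hβ]
        simp only [Pi.smul_apply, smul_assoc]
        rw [← Finset.smul_sum, hδS, smul_zero]
      have h1 : ∑ i, β i • S i = u := by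
        simp only [β, Finset.sum_smul, mul_smul]
        rw [Finset.sum_comm]
        simp only [← Finset.smul_sum, hα]
        funext w
        simp [uncoded, Pi.single_apply]
      rw [← h1, h0])
  let pos : Fin (K + 1) → Bool → Fin (n + 1) := fun c t => p (if t then c.succ else c.castSucc)
  have hpos : ∀ c t, (if t = true then p c.succ else p c.castSucc) = pos c t := fun c t => by
    cases t <;> rfl
  simp only [hpos] at hin hinj
  -- the positions of the chain
  let D : Finset (Fin (n + 1)) := Finset.univ.filter fun i =>
    i ∈ Set.range p ∧ ∀ c t, τ c = some t → pos c t ≠ i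
  have hmemD : ∀ i, i ∈ D ↔ i ∈ Set.range p ∧ ∀ c t, τ c = some t → pos c t ≠ i := by simp [D]
  -- Both ends survive: a chunk that deletes a position has coordinate zero at `p 0` by the choice
  -- of transversal, and at the last position by normalization.
  have h0D : p 0 ∈ D := (hmemD _).2 ⟨⟨_, rfl⟩, fun c t h h' => by
    have := hin c t h
    rw [h'] at this
    exact this.2 this.1⟩
  have hlD : p (Fin.last _) ∈ D := (hmemD _).2 ⟨⟨_, rfl⟩, fun c t h h' => by
    have := hin c t h
    rw [h'] at this
    exact this.2 (hαl _)⟩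
  obtain ⟨N, hD⟩ : ∃ N, D.card = N + 1 := ⟨D.card - 1, by
    have := Finset.card_pos.2 ⟨_, h0D⟩
    omega⟩
  have hN : 1 ≤ N := by
    have : 1 < D.card := Finset.one_lt_card.2 ⟨_, h0D, _, hlD, fun h => by
      have := p.injective h
      rw [Fin.ext_iff] at this
      simp at this⟩
    omega
  have hNn : N ≤ n := by
    have := D.card_le_univ
    rw [Fintype.card_fin] at this
    omega
  have hcut : ∀ c : Fin (K + 1), ∃ j : Fin N,
      ∀ i, D.orderEmbOfFin hD i ≤ p c.castSucc ↔ i ≤ j.castSucc := fun c =>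
    exists_orderEmbOfFin_le_iff D hD _ ⟨_, h0D, p.monotone (Fin.zero_le _)⟩
      ⟨_, hlD, p.strictMono (Fin.castSucc_lt_last c)⟩
  choose cut hcut using hcut
  have hposD : ∀ c t, τ c = some t → pos c t ∉ D := fun c t h h' => ((hmemD _).1 h').2 c t h rfl
  let Θ : {i // i ∉ Set.range p} ⊕ Fin (K + 1) → {i // i ∉ D} ⊕ Fin N → Prop := fun c s =>
    match c with
    | Sum.inl i => ∃ h, s = Sum.inl ⟨i, h⟩
    | Sum.inr c => (∃ t h, τ c = some t ∧ s = Sum.inl ⟨pos c t, h⟩) ∨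
        (τ c = none ∧ s = Sum.inr (cut c))
  have hΘex : ∀ c, ∃ s, Θ c s := by
    rintro (i | c)
    · exact ⟨Sum.inl ⟨i, fun h => i.2 ((hmemD _).1 h).1⟩, _, rfl⟩
    · rcases h : τ c with _ | t
      · exact ⟨_, Or.inr ⟨h, rfl⟩⟩
      · exact ⟨_, Or.inl ⟨t, hposD c t h, h, rfl⟩⟩
  -- A surviving position between two cuts separates them.
  have hcutinj : ∀ c c', τ c = none → τ c' = none → c < c' → cut c ≠ cut c' := by
    intro c c' hc hc' hcc h
    obtain ⟨j, hj1, hj2, hj⟩ := exists_not_deleted_between τ hcc hc hc'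
    have hjD : p j ∈ D := (hmemD _).2 ⟨⟨j, rfl⟩, fun e t he h => hj e t he (p.injective h)⟩
    obtain ⟨i, hi⟩ := exists_orderEmbOfFin_eq D hD hjD
    have h1 := (hcut c' i).1 (by rw [hi]; exact p.monotone hj2)
    rw [← h, ← hcut c, hi, p.le_iff_le] at h1
    exact absurd h1 (not_le.2 hj1)
  have hΘinj : ∀ c c' s, Θ c s → Θ c' s → c = c' := by
    rintro (i | c) (i' | c') s h h'
    · obtain ⟨_, rfl⟩ := h
      obtain ⟨_, h'⟩ := h'
      have := congrArg Subtype.val (Sum.inl.inj h')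
      exact congrArg Sum.inl (Subtype.ext this)
    · obtain ⟨_, rfl⟩ := h
      rcases h' with ⟨t, _, _, h'⟩ | ⟨_, h'⟩
      · exact absurd ⟨_, (congrArg Subtype.val (Sum.inl.inj h')).symm⟩ i.2
      · cases h'
    · obtain ⟨_, rfl⟩ := h'
      rcases h with ⟨t, _, _, h⟩ | ⟨_, h⟩
      · exact absurd ⟨_, (congrArg Subtype.val (Sum.inl.inj h)).symm⟩ i'.2
      · cases h
    · rcases h with ⟨t, _, ht, rfl⟩ | ⟨hc, rfl⟩ <;> rcases h' with ⟨t', _, ht', h'⟩ | ⟨hc', h'⟩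
      · exact congrArg Sum.inr
          (hinj c t c' t' ht ht' (congrArg Subtype.val (Sum.inl.inj h')))
      · cases h'
      · cases h'
      · have hcut' := Sum.inr.inj h'
        rcases lt_trichotomy c c' with h | h | h
        · exact absurd hcut' (hcutinj c c' hc hc' h)
        · rw [h]
        · exact absurd hcut'.symm (hcutinj c' c hc' hc h)
  choose θ hθ using hΘex
  have hbij : Function.Bijective (fun v => θ (σ.symm v)) := by
    rw [Fintype.bijective_iff_injective_and_card]
    refine ⟨fun v w h => σ.symm.injective (hΘinj _ _ _ (hθ _) ?_), ?_⟩
    · have h' : θ (σ.symm v) = θ (σ.symm w) := h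
      rw [h']
      exact hθ _
    · have h1 := Fintype.card_subtype_compl (fun i => i ∈ D)
      rw [Fintype.card_coe, hD, Fintype.card_fin] at h1
      rw [Fintype.card_sum, h1, hV, Fintype.card_fin]
      omega
  refine ⟨N, hN, hNn, D, hD, Equiv.ofBijective _ hbij, ?_⟩
  rintro v W hW ⟨β, hβW, hβ⟩
  have hβα := hrep v β hβ
  obtain ⟨c, rfl⟩ := σ.surjective v
  have hθc := hθ c
  simp only [Equiv.ofBijective_apply, Equiv.symm_apply_apply]
  rcases c with a | c
  · obtain ⟨_, hs⟩ := hθc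
    rw [hs]
    refine ⟨?_, fun j h => by cases h⟩
    rintro _ ⟨⟩
    apply hβW
    -- Since `δ` vanishes at `a`, both representations use this position.
    rcases hβα with h | h
    · rw [h]; exact hA a
    · rw [h, Pi.add_apply, hδn a a.2, add_zero]; exact hA a
  · rcases hθc with ⟨t, _, ht, hs⟩ | ⟨hc, hs⟩
    · rw [hs]
      refine ⟨?_, fun j h => by cases h⟩
      rintro _ ⟨⟩
      obtain ⟨hv0, hvt⟩ := hin c t ht
      -- `α v` uses the position itself; `α v + δ` uses both ends of the relation, and convexity of
      -- `W` gives the position.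
      rcases hβα with h | h
      · apply hβW
        rw [h]; exact hvt
      · have h0W : p 0 ∈ W := hβW _ (by
          rw [h, Pi.add_apply, hv0, hδp]; exact one_ne_zero)
        have hlW : p (Fin.last _) ∈ W := hβW _ (by
          rw [h, Pi.add_apply, hαl, hδp]; exact one_ne_zero)
        exact hW.out h0W hlW ⟨p.monotone (Fin.zero_le _), p.monotone (Fin.le_last _)⟩
    · rw [hs]
      refine ⟨fun i h => by (cases h), ?_⟩
      rintro _ ⟨⟩
      obtain ⟨hv0, hvc⟩ := hout c hc
      -- Exactly one of the coordinates at `c.castSucc` and `c.succ` is nonzero, and adding `δ`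
      -- swaps them. So `α v` reaches from `p 0` at least to `p c.castSucc`, and `α v + δ` from `p
      -- c.succ` or earlier to the last position.
      rcases hβα with h | h
      · left
        intro i hi
        have h0W : p 0 ∈ W := hβW _ (by rw [h]; exact hv0)
        have hi' := (hcut c i).2 hi
        have hiD := ((hmemD _).1 (D.orderEmbOfFin_mem hD i)).1
        obtain ⟨k, hk⟩ := hiD
        rw [← hk] at hi' ⊢
        have hk0 : p 0 ≤ p k := p.monotone (Fin.zero_le _)
        by_cases hcs : α (σ (Sum.inr c)) (p c.castSucc) = 0
        · rw [hcs, zero_add] at hvc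
          exact hW.out h0W (hβW _ (by rw [h]; exact hvc))
            ⟨hk0, hi'.trans (p.monotone (Fin.castSucc_le_succ c))⟩
        · exact hW.out h0W (hβW _ (by rw [h]; exact hcs)) ⟨hk0, hi'⟩
      · right
        intro i hi
        have hlW : p (Fin.last _) ∈ W := hβW _ (by
          rw [h, Pi.add_apply, hαl, hδp]; exact one_ne_zero)
        have hi' := mt (hcut c i).1 hi
        have hiD := ((hmemD _).1 (D.orderEmbOfFin_mem hD i)).1
        obtain ⟨k, hk⟩ := hiD
        rw [← hk, not_le, p.lt_iff_lt] at hi'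
        rw [← hk]
        have hkl : p k ≤ p (Fin.last _) := p.monotone (Fin.le_last _)
        rcases h01 (α (σ (Sum.inr c)) (p c.castSucc)) with hcs | hcs
        · exact hW.out (hβW _ (by
            rw [h, Pi.add_apply, hcs, hδp]; exact one_ne_zero)) hlW ⟨p.monotone hi'.le, hkl⟩
        · rcases h01 (α (σ (Sum.inr c)) (p c.succ)) with hcs' | hcs'
          · exact hW.out (hβW _ (by
              rw [h, Pi.add_apply, hcs', hδp]; exact one_ne_zero)) hlW
              ⟨p.monotone (Fin.castSucc_lt_iff_succ_le.1 hi'), hkl⟩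
          · rw [hcs, hcs'] at hvc
            exact absurd rfl hvc

/-! ### Domination and the optimum -/

variable {V : Type*} [Fintype V] {m : ℕ}

theorem window_ordConnected (m s L : ℕ) : (window m s L).OrdConnected :=
  ⟨fun _ hx _ hy _ hz => ⟨hx.1.trans (Fin.le_def.1 hz.1), (Fin.le_def.1 hz.2).trans_lt hy.2⟩⟩

/-- A store that recovers from each substring at least as much as a coded store does is coded and
has a stretch metric that is at most as large. -/
theorem stretchMetric_le_of_recovers {d : ℕ} {G : SimpleGraph V} {t : ℕ} (ht : 1 ≤ t) [Nonempty V]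
    {S S' : LinStore V m} (hS : S ∈ codedStores d G t m)
    (h : ∀ v (W : Set (Fin m)), W.OrdConnected → Recovers d S W v → Recovers d S' W v) :
    S' ∈ codedStores d G t m ∧ stretchMetric d G t S' ≤ stretchMetric d G t S := by
  refine ⟨fun p hp v hv => h v _ Set.ordConnected_univ (hS p hp v hv), ?_⟩
  refine csSup_le (Set.Nonempty.image _ ⟨_, singleton_mem_fileModel G ht (Classical.arbitrary V)⟩) ?_
  rintro _ ⟨p, hp, rfl⟩
  refine le_trans ?_ (le_csSup ((fileModel_finite G t).image _).bddAbove ⟨p, hp, rfl⟩)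
  refine div_le_div_of_nonneg_right (Nat.cast_le.2 (Nat.sInf_le ?_)) (Nat.cast_nonneg _)
  obtain ⟨s, hs, hrec⟩ := shortest_spec hS hp
  exact ⟨s, hs, fun v hv => h v _ (window_ordConnected _ _ _) (hrec v hv)⟩

/-- A store that recovers everything satisfies a relation on at least two positions, after replacing
a zero entry if necessary. -/
theorem exists_relation [DecidableEq V] {n : ℕ} (hn : 1 ≤ n) (hV : Fintype.card V = n)
    (S : LinStore V (n + 1)) :
    ∃ (S' : LinStore V (n + 1)) (K : ℕ) (p : Fin (K + 2) ↪o Fin (n + 1)),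
      ∑ j, S' (p j) = 0 ∧ ∀ (W : Set (Fin (n + 1))) (f : V → ZMod 2),
        (∃ β : Fin (n + 1) → ZMod 2, (∀ i, β i ≠ 0 → i ∈ W) ∧ ∑ i, β i • S i = f) →
          ∃ β : Fin (n + 1) → ZMod 2, (∀ i, β i ≠ 0 → i ∈ W) ∧ ∑ i, β i • S' i = f := by
  classical
  have hof : ∀ (S' : LinStore V (n + 1)) (D : Finset (Fin (n + 1))), 1 < D.card →
      ∑ i ∈ D, S' i = 0 →
      ∃ (K : ℕ) (p : Fin (K + 2) ↪o Fin (n + 1)), ∑ j, S' (p j) = 0 := by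
    intro S' D hD hsum
    refine ⟨D.card - 2, D.orderEmbOfFin (by omega), ?_⟩
    rw [← hsum]
    refine Finset.sum_nbij (D.orderEmbOfFin (by omega)) (fun j _ => D.orderEmbOfFin_mem _ j)
      (RelEmbedding.injective _).injOn (fun i hi => ?_) fun _ _ => rfl
    obtain ⟨j, hj⟩ := exists_orderEmbOfFin_eq D (k := D.card - 2 + 2) (by omega) hi
    exact ⟨j, by simp, hj⟩
  have hdep : ¬ LinearIndependent (ZMod 2) S := fun h => by
    have := h.fintype_card_le_finrank
    rw [Fintype.card_fin, Module.finrank_fintype_fun_eq_card, hV] at this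
    omega
  obtain ⟨δ, hδ, i₀, hi₀⟩ := Fintype.not_linearIndependent_iff.1 hdep
  have h01 : ∀ c : ZMod 2, c = 0 ∨ c = 1 := by decide
  let D : Finset (Fin (n + 1)) := Finset.univ.filter (δ · ≠ 0)
  have hD : ∑ i ∈ D, S i = 0 := by
    rw [← hδ, Finset.sum_filter]
    refine Finset.sum_congr rfl fun i _ => ?_
    rcases h01 (δ i) with h | h <;> simp [h]
  by_cases hcard : 1 < D.card
  · obtain ⟨K, p, hp⟩ := hof S D hcard hD
    exact ⟨S, K, p, hp, fun _ _ h => h⟩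
  have hDi : D = {i₀} := (Finset.eq_of_subset_of_card_le (by simpa [D] using hi₀)
    (by rw [Finset.card_singleton]; omega)).symm
  rw [hDi, Finset.sum_singleton] at hD
  have : Nontrivial (Fin (n + 1)) := Fin.nontrivial_iff_two_le.2 (by omega)
  -- The entry at `i₀` is zero, so overwriting it with a copy of another entry loses nothing and
  -- creates a relation on two positions.
  obtain ⟨i₁, hi₁⟩ := exists_ne i₀
  obtain ⟨K, p, hp⟩ := hof (Function.update S i₀ (S i₁)) {i₀, i₁}
    (by rw [Finset.card_pair hi₁.symm]; norm_num) (by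
      rw [Finset.sum_pair hi₁.symm, Function.update_self, Function.update_of_ne hi₁,
        add_self_eq_zero_zmod_two])
  refine ⟨_, K, p, hp, ?_⟩
  rintro W f ⟨β, hβW, hβ⟩
  refine ⟨Function.update β i₀ 0, fun i hi => ?_, ?_⟩
  · by_cases h : i = i₀
    · simp [h] at hi
    · rw [Function.update_of_ne h] at hi
      exact hβW i hi
  · rw [← hβ]
    refine Finset.sum_congr rfl fun i _ => ?_
    by_cases h : i = i₀
    · subst h; simp [hD]
    · simp [Function.update_of_ne h]

/-- Every coded store with one redundant chunk is dominated by an interleaving of uncoded chunks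
with a chain. -/
theorem exists_interleaving_recovers [DecidableEq V] {n d : ℕ} (hn : 1 ≤ n) (hd : 1 ≤ d)
    (hV : Fintype.card V = n) (S : LinStore V (n + 1)) (hS : ∀ v, Recovers d S Set.univ v) :
    ∃ (S' : LinStore V (n + 1)) (N : ℕ) (hN : 1 ≤ N) (_ : N ≤ n) (a : Fin (n - N) → V)
      (b : Fin N → V), Function.Bijective (Sum.elim a b) ∧
        IsInterleaving (fun i => uncoded (a i)) (chain hN b) S' ∧
        ∀ v (W : Set (Fin (n + 1))), W.OrdConnected → Recovers d S W v → Recovers d S' W v := by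
  obtain ⟨T, K, p, hp, hT⟩ := exists_relation hn hV S
  have hTspan : ∀ v, ∃ α : Fin (n + 1) → ZMod 2, ∑ i, α i • T i = uncoded v := fun v =>
    (hT _ _ ((hS v).exists_sum_eq hd)).imp fun _ h => h.2
  obtain ⟨N, hN, hNn, D, hD, θ, hθ⟩ := exists_placement hV T hTspan p hp
  obtain ⟨S', a, b, hab, hint, hout, hin⟩ := exists_interleaving_store hN hNn D hD θ
  refine ⟨S', N, hN, hNn, a, b, hab, hint, fun v W hW hrec => ?_⟩
  obtain ⟨h1, h2⟩ := hθ v W hW (hT _ _ (hrec.exists_sum_eq hd))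
  have hmap : ∀ A : Finset (Fin (N + 1)), (∀ i ∈ A, D.orderEmbOfFin hD i ∈ W) →
      ∑ i ∈ A, S' (D.orderEmbOfFin hD i) = uncoded v → Recovers d S' W v := fun A hA hsum => by
    refine recovers_of_sum_finset (A.map (D.orderEmbOfFin hD).toEmbedding) (fun i hi => ?_) ?_
    · obtain ⟨j, hj, rfl⟩ := Finset.mem_map.1 hi
      exact hA j hj
    · rw [Finset.sum_map]
      exact hsum
  rcases h : θ v with i | j
  · refine recovers_of_sum_finset {(i : Fin (n + 1))} (fun k hk => ?_) ?_
    · rw [Finset.mem_singleton.1 hk]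
      exact h1 i h
    · rw [Finset.sum_singleton, hout, ← h, Equiv.symm_apply_apply]
  · obtain ⟨hpre, hsuf⟩ := hin j
    rw [← h, Equiv.symm_apply_apply] at hpre hsuf
    rcases h2 j h with hW' | hW'
    · exact hmap _ (fun i hi => hW' i (Finset.mem_filter.1 hi).2) hpre
    · exact hmap _ (fun i hi => hW' i (Finset.mem_filter.1 hi).2) hsuf

theorem codedStores_nonempty [DecidableEq V] {n : ℕ} (hV : Fintype.card V = n) (d : ℕ)
    (G : SimpleGraph V) (t : ℕ) : (codedStores d G t (n + 1)).Nonempty := by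
  let e : V ≃ Fin n := Fintype.equivFinOfCardEq hV
  refine ⟨Fin.snoc (fun i => uncoded (e.symm i)) 0, fun p _ v _ =>
    recovers_of_sum_finset {(e v).castSucc} (fun _ _ => Set.mem_univ _) ?_⟩
  rw [Finset.sum_singleton]
  simp

end Dedup

theorem mainTheorem2 {V : Type*} [Fintype V] [DecidableEq V] (n : ℕ) (hn : Fintype.card V = n)
    (G : SimpleGraph V) (t : ℕ) (ht : 1 ≤ t) (htn : t ≤ n) (d : ℕ) (hd : 1 ≤ d) :
    ∃ S : Dedup.LinStore V (n + 1), Dedup.IsOptimalStore d G t S ∧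
      ∃ (N : ℕ) (hN : 1 ≤ N) (_ : N ≤ n) (a : Fin (n - N) → V) (b : Fin N → V),
        Function.Bijective (Sum.elim a b) ∧
        Dedup.IsInterleaving (fun i => Dedup.uncoded (a i)) (Dedup.chain hN b) S := by
  have : Nonempty V := Fintype.card_pos_iff.1 (by omega)
  -- A minimizer exists because there are only finitely many stores of a given length.
  obtain ⟨S, hS, hmin⟩ := Set.exists_min_image _ (Dedup.stretchMetric d G t) (Set.toFinite _)
    (Dedup.codedStores_nonempty hn d G t)
  obtain ⟨S', N, hN, hNn, a, b, hab, hint, hrec⟩ := Dedup.exists_interleaving_recovers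
    (ht.trans htn) hd hn S fun v =>
      hS _ (Dedup.singleton_mem_fileModel G ht v) v (List.mem_singleton_self v)
  obtain ⟨hS', hle⟩ := Dedup.stretchMetric_le_of_recovers ht hS hrec
  exact ⟨S', ⟨hS', fun T hT => hle.trans (hmin T hT)⟩, N, hN, hNn, a, b, hab, hint⟩
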